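/- Let $\tau=(x_1,\dots,x_N)$, $N\ge 1$, be a finite time series of strictly positive real numbers. *The graph.* The horizon visibility graph $\mathrm{HVG}_\infty(\tau)$ has vertices $0,1,\dots,N+1$; with $x_0=x_{N+1}=\infty$, vertices $i<j$ are adjacent iff $x_k<x_i$ and $x_k<x_j$ for all $i<k<j$. Let $\check\tau$ be the path with vertices $0,\dots,N$ whose edge $\{i-1,i\}$ has weight $x_i$, and let $T_{\check\tau}$ be its merge tree: its nodes are the distinct connected components $C$ of the sublevel graphs $\check\tau_a$, $a\ge 0$ (all vertices, and the edges of weight $\le a$), ordered by inclusion, the height of $C$ being the least $a\ge 0$ for which $C$ is a component of $\check\tau_a$. The edge above $C$ spans $[\alpha,\beta)$ with $\alpha$ the height of $C$ and $\beta$ that of its parent, and has length $\beta-\alpha$; the edge above the root has an arbitrary fixed length $r>0$. Draw $T_{\check\tau}$ in a disk with the leaves $0,\dots,N$ and the free end $\infty$ of the root edge on the circle, in this cyclic order, and let region $g\in\{0,\dots,N+1\}$ of the complement be the one that touches the circle between the leaves $g-1$ and $g$ (leaf $-1$ and leaf $N+1$ being read as $\infty$). The persistence weighted horizon visibility graph is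 $\mathrm{HVG}_\infty(\tau)$ in which each edge $\{i,j\}$ has as its weight the length of the edge of $T_{\check\tau}$ dual to it, i.e. of the tree edge shared by the boundaries of regions $i$ and $j$. *The pruned tree.* Let $T$ be the rooted tree dual to this weighted graph: its edges correspond to the edges $i<j$ of the graph, with the weights as lengths, each node being identified with the tree edge above it; $(i,j)$ is a descendant of $(i',j')$ iff $i'\le i<j\le j'$; and heights are measured from the leaves, which have height $0$. Let $T'$ be the first Horton pruning of $T$: delete all leaves with the edges above them, then suppress all vertices of degree two (nodes with exactly one child; the root also has an edge above it), keeping the heights of the remaining nodes. *The Elder Rule.* Choose any way (a strict total order) of breaking ties between leaves of equal height; a leaf is older than another if it is lower, or equally high and preferred by the tie-break. The Elder Rule assigns to each leaf $\ell$ of $T'$ the interval $[b,d)$, where $b$ is the height of $\ell$ and $d$ is the height of the lowest ancestor of $\ell$ below which there is a leaf older than $\ell$, with $d=\infty$ for the oldest leaf. **Proposition.** The multiset of intervals which the Elder Rule assigns to $T'$ is the $0$-dimensional persistence barcode of the piecewise linear interpolation $\mathrm{PL}_\tau:[1,N]\to\mathbb R$, $\mathrm{PL}_\tau(i)=x_i$.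 That is, all these intervals are non-empty, and for every field $k$ the persistence module $a\mapsto H_0(\{t\in[1,N]:\mathrm{PL}_\tau(t)\le a\};k)$, $a\in\mathbb R$, where $H_0$ is the free vector space on the connected components and the maps are induced by inclusion, is isomorphic to the direct sum of the interval modules of these intervals. -/

import Mathlib

noncomputable section

namespace HorizonTree

open CategoryTheory
open scoped Classical

/-! ### Horizontal and horizon visibility -/

/-- The horizontal visibility graph of a sequence `x`: two distinct indices are adjacent when every
value strictly between them is smaller than both of their values. -/
def horizontalVisibilityGraph {α : Type} [LinearOrder α] {m : ℕ} (x : Fin m → α) :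
    SimpleGraph (Fin m) where
  Adj i j := i ≠ j ∧ ∀ k, min i j < k → k < max i j → x k < x i ∧ x k < x j
  symm := ⟨fun i j h => ⟨h.1.symm, fun k h₁ h₂ =>
    (h.2 k (by rwa [min_comm]) (by rwa [max_comm])).symm⟩⟩
  loopless := ⟨fun _ h => h.1 rfl⟩

/-- The sequence `(∞, x₁, …, x_N, ∞)`. -/
def withHorizons {N : ℕ} (τ : Fin N → ℝ) : Fin (N + 2) → EReal :=
  Fin.cons ⊤ (Fin.snoc (α := fun _ => EReal) (fun i => (τ i : EReal)) ⊤)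

/-- The horizon visibility graph of a time series. -/
def horizonVisibilityGraph {N : ℕ} (τ : Fin N → ℝ) : SimpleGraph (Fin (N + 2)) :=
  horizontalVisibilityGraph (withHorizons τ)

/-! ### Weighted graphs, sublevel graphs and merge trees -/

/-- A graph with a weight on its edges (the values of `weight` off the edges play no role). -/
structure WeightedGraph (V : Type) where
  graph : SimpleGraph V
  weight : Sym2 V → ℝ

/-- The sublevel graph `G_a`: all the vertices, and the edges of weight at most `a`. -/
def WeightedGraph.sublevel {V : Type} (G : WeightedGraph V) (a : ℝ) : SimpleGraph V where
  Adj v w := G.graph.Adj v w ∧ G.weight s(v, w) ≤ a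
  symm := ⟨fun v w h => ⟨h.1.symm, by rw [Sym2.eq_swap]; exact h.2⟩⟩
  loopless := ⟨fun _ h => h.1.ne rfl⟩

/-- `C` is (the vertex set of) a connected component of the sublevel graph `G_a`. -/
def WeightedGraph.IsComponent {V : Type} (G : WeightedGraph V) (a : ℝ) (C : Set V) : Prop :=
  ∃ c : (G.sublevel a).ConnectedComponent, c.supp = C

/-- A finite rooted tree with heights. The tree is presented by its set of nodes inside a partial
order, where `v ≤ w` means that `v` is a descendant of `w`. -/
structure HeightTree (α : Type) where
  nodes : Set α
  height : α → ℝ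

/-- The merge tree of a graph with positive weights. Its nodes are the vertex sets of the connected
components of the sublevel graphs `G_a`, `a ≥ 0`, ordered by inclusion; the height of a node is the
threshold at which this component appears. -/
def WeightedGraph.mergeTree {V : Type} (G : WeightedGraph V) : HeightTree (Set V) where
  nodes := {C | ∃ a : ℝ, 0 ≤ a ∧ G.IsComponent a C}
  height C := sInf {a : ℝ | 0 ≤ a ∧ G.IsComponent a C}

/-- The length `β - α` of the edge above a node `v`, where `[α, β)` is the interval that this edge
spans: `α` is the height of `v` and `β` is the height of its parent. The edge above the root has the
prescribed length `r`. -/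
def HeightTree.edgeLength {α : Type} [PartialOrder α] (T : HeightTree α) (r : ℝ) (v : α) : ℝ :=
  if ∃ w ∈ T.nodes, v < w then sInf (T.height '' {w | w ∈ T.nodes ∧ v < w}) - T.height v else r

/-- The weighted path of a time series: vertices `0, …, N`, and an edge of weight `x_i` between
`i - 1` and `i`. -/
def weightedPath {N : ℕ} (τ : Fin N → ℝ) : WeightedGraph (Fin (N + 1)) where
  graph := SimpleGraph.pathGraph (N + 1)
  weight e := ∑ i : Fin N, if e = s(i.castSucc, i.succ) then τ i else 0

/-! ### Duality and persistence weights

Draw the merge tree of the weighted path of `τ` in a disk, with its leaves `0, …, N` and the free end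
`∞` of its root edge on the boundary circle, in this cyclic order. The complement of the tree has
`N + 2` regions: region `g` touches the circle between leaf `g - 1` and leaf `g`, where for `g = 0`
the former, and for `g = N + 1` the latter, is `∞`. -/

/-- The tree edge above the node with leaf set `C` lies on the boundary of region `g`. This boundary
consists of the tree path between the two ends of the circular arc of `g`, so the condition is that
exactly one of these two ends lies below the edge. -/
def OnBoundary {N : ℕ} (C : Set (Fin (N + 1))) (g : Fin (N + 2)) : Prop :=
  Xor (∃ v ∈ C, v.succ = g) (∃ v ∈ C, v.castSucc = g)

/-- The persistence weighted horizon visibility graph: the weight of the edge between `g` and `g'`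
is the length `β - α` of the merge tree edge dual to it, that is, of the tree edge shared by the
boundaries of the regions `g` and `g'` (two regions share at most one edge). The root edge of the
merge tree has length `r`. -/
def persistenceWeightedHVG {N : ℕ} (τ : Fin N → ℝ) (r : ℝ) : WeightedGraph (Fin (N + 2)) where
  graph := horizonVisibilityGraph τ
  weight e := ∑ C : Set (Fin (N + 1)) with
    C ∈ (weightedPath τ).mergeTree.nodes ∧ ∀ g ∈ e, OnBoundary C g,
    (weightedPath τ).mergeTree.edgeLength r C

/-! ### The tree dual to a weighted horizon visibility graph -/

/-- `v` is a leaf of the tree with node set `S`. -/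
def IsLeaf {α : Type} [PartialOrder α] (S : Set α) (v : α) : Prop :=
  Minimal (· ∈ S) v

/-- `c` is a child of `v` in the tree with node set `S`. -/
def IsChild {α : Type} [PartialOrder α] (S : Set α) (c v : α) : Prop :=
  c ∈ S ∧ v ∈ S ∧ c < v ∧ ∀ d ∈ S, c < d → ¬ d < v

/-- The height function of a rooted tree with node set `S` and edge lengths `len` (`len v` being the
length of the edge above `v`) all of whose leaves have height zero: the height of `v` is the length
of a descending path from `v` to a leaf. -/
def heightOfLengths {α : Type} [PartialOrder α] [Fintype α] (S : Set α) (len : α → ℝ) (v : α) : ℝ :=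
  ⨆ l : {l : α // IsLeaf S l ∧ l ≤ v}, ∑ w : α with w ∈ S ∧ l.1 ≤ w ∧ w < v, len w

/-- The rooted tree dual to a weighted graph such as the persistence weighted horizon visibility
graph, whose edges are drawn as non-crossing arcs over `0 < 1 < … < m - 1`. The tree edges correspond
to the edges `i < j` of the graph, and a node of the tree is identified with the tree edge above it;
the pair `(i, j)` is a descendant of `(i', j')` when `i' ≤ i` and `j ≤ j'`. The tree edge has the
length given by the weight of the edge of the graph, and the leaves have height zero. -/
def dualTree {m : ℕ} (G : WeightedGraph (Fin m)) : HeightTree ((Fin m)ᵒᵈ × Fin m) where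
  nodes := {p | OrderDual.ofDual p.1 < p.2 ∧ G.graph.Adj (OrderDual.ofDual p.1) p.2}
  height := heightOfLengths
    {p | OrderDual.ofDual p.1 < p.2 ∧ G.graph.Adj (OrderDual.ofDual p.1) p.2}
    (fun p => G.weight s(OrderDual.ofDual p.1, p.2))

/-! ### Horton pruning and the Elder Rule -/

/-- Cut off the leaves of a tree, together with their parental edges. -/
def cutLeaves {α : Type} [PartialOrder α] (S : Set α) : Set α :=
  {v ∈ S | ¬ IsLeaf S v}

/-- Remove the vertices of degree two of a rooted tree. As there is an edge above every node (the root
edge for the root), these are the nodes with exactly one child. -/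
def suppressDegreeTwo {α : Type} [PartialOrder α] (S : Set α) : Set α :=
  {v ∈ S | ¬ ∃! c, IsChild S c v}

/-- The first Horton pruning; the remaining nodes keep their heights. -/
def HeightTree.hortonPruning {α : Type} [PartialOrder α] (T : HeightTree α) : HeightTree α where
  nodes := suppressDegreeTwo (cutLeaves T.nodes)
  height := T.height

/-- `l'` is older than `l`: it is born earlier, or at the same height and `tie` prefers it. -/
def HeightTree.Older {α : Type} (T : HeightTree α) (tie : α → α → Prop) (l' l : α) : Prop :=
  T.height l' < T.height l ∨ T.height l' = T.height l ∧ tie l' l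

/-- The height at which the branch born at the leaf `l` dies: the height of the lowest ancestor of
`l` that has an older leaf among its descendants, and `∞` when `l` is the oldest leaf of the tree. -/
def HeightTree.death {α : Type} [PartialOrder α] (T : HeightTree α) (tie : α → α → Prop)
    (l : α) : EReal :=
  sInf {d : EReal | ∃ v ∈ T.nodes, l ≤ v ∧ (∃ l', IsLeaf T.nodes l' ∧ l' ≤ v ∧ T.Older tie l' l) ∧
    d = (T.height v : EReal)}

/-- The Elder Rule: one bar `[birth, death)` for each leaf of the tree. When branches merge, the
oldest of them survives and all the others die. -/
def HeightTree.elderRule {α : Type} [PartialOrder α] [Fintype α] (T : HeightTree α)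
    (tie : α → α → Prop) : Multiset (ℝ × EReal) :=
  (Finset.univ.filter (fun l : α => IsLeaf T.nodes l)).val.map
    (fun l => (T.height l, T.death tie l))

/-! ### Sublevel set persistent homology in degree zero -/

/-- Zeroth homology of the sublevel sets `{x | f x ≤ a}` with coefficients in `k`: the free vector
spaces on their connected components, with the maps induced by the inclusions. -/
def sublevelH0 (k : Type*) [Field k] {X : Type} [TopologicalSpace X] (f : X → ℝ) :
    ℝ ⥤ ModuleCat k where
  obj a := ModuleCat.of k (ConnectedComponents {x : X // f x ≤ a} →₀ k)
  map {a b} h := ModuleCat.ofHom (Finsupp.lmapDomain k k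
    (Continuous.connectedComponentsMap
      (f := fun x : {x : X // f x ≤ a} => (⟨x.1, x.2.trans (leOfHom h)⟩ : {x : X // f x ≤ b}))
      (by fun_prop)))
  map_id a := by
    apply ModuleCat.hom_ext
    rw [ModuleCat.hom_ofHom, ModuleCat.hom_id]
    refine Eq.trans ?_ (Finsupp.lmapDomain_id k k)
    congr 1
    funext c
    obtain ⟨x, rfl⟩ := ConnectedComponents.surjective_coe c
    rfl
  map_comp {a b c} h h' := by
    apply ModuleCat.hom_ext
    rw [ModuleCat.hom_ofHom, ModuleCat.hom_comp, ModuleCat.hom_ofHom, ModuleCat.hom_ofHom,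
      ← Finsupp.lmapDomain_comp]
    congr 1
    funext c
    obtain ⟨x, rfl⟩ := ConnectedComponents.surjective_coe c
    rfl

/-- The parameter `a` lies in the half open interval `[I.1, I.2)`. -/
def InBar (I : ℝ × EReal) (a : ℝ) : Prop :=
  I.1 ≤ a ∧ (a : EReal) < I.2

/-- The value at `a` of the direct sum of the interval modules of the intervals `I j`: a copy of `k`
for each interval that contains `a`. -/
def intervalSumObj (k : Type*) [Field k] {ι : Type} (I : ι → ℝ × EReal) (a : ℝ) :
    Submodule k (ι → k) where
  carrier := {c | ∀ j, ¬ InBar (I j) a → c j = 0}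
  add_mem' := fun {c d} hc hd j hj => by simp [hc j hj, hd j hj]
  zero_mem' := fun _ _ => rfl
  smul_mem' := fun s c hc j hj => by simp [hc j hj]

/-- The structure maps of a direct sum of interval modules: the identity on the copy of `k` belonging
to an interval that still contains `b`, and zero on the others. -/
def intervalSumMap (k : Type*) [Field k] {ι : Type} (I : ι → ℝ × EReal) (a b : ℝ) :
    intervalSumObj k I a →ₗ[k] intervalSumObj k I b where
  toFun c := ⟨fun j => if InBar (I j) b then c.1 j else 0, fun _ hj => if_neg hj⟩
  map_add' c d := by
    ext j
    by_cases hj : InBar (I j) b <;> simp [hj]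
  map_smul' s c := by
    ext j
    by_cases hj : InBar (I j) b <;> simp [hj]

/-- The direct sum of the interval modules of a finite family of intervals. -/
def intervalSum (k : Type*) [Field k] {ι : Type} [Finite ι] (I : ι → ℝ × EReal) :
    ℝ ⥤ ModuleCat k where
  obj a := ModuleCat.of k (intervalSumObj k I a)
  map {a b} _ := ModuleCat.ofHom (intervalSumMap k I a b)
  map_id a := by
    apply ModuleCat.hom_ext
    apply LinearMap.ext
    intro c
    apply Subtype.ext
    funext j
    change (if InBar (I j) a then c.1 j else 0) = c.1 j
    split_ifs with hj
    · rfl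
    · exact (c.2 j hj).symm
  map_comp {a b d} h h' := by
    apply ModuleCat.hom_ext
    apply LinearMap.ext
    intro c
    apply Subtype.ext
    funext j
    change (if InBar (I j) d then c.1 j else 0) =
      if InBar (I j) d then (if InBar (I j) b then c.1 j else 0) else 0
    by_cases hd : InBar (I j) d
    · by_cases hb : InBar (I j) b
      · simp [hd, hb]
      · have hc : c.1 j = 0 := c.2 j fun ha => hb
          ⟨ha.1.trans (leOfHom h), lt_of_le_of_lt (by exact_mod_cast leOfHom h') hd.2⟩
        simp [hc]
    · simp [hd]

/-- `B` is the barcode of the persistence module `M`: a finite multiset of nonempty intervals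
`[birth, death)` such that `M` is isomorphic to the direct sum of their interval modules. -/
def IsBarcode {k : Type*} [Field k] (M : ℝ ⥤ ModuleCat k) (B : Multiset (ℝ × EReal)) : Prop :=
  (∀ I ∈ B, (I.1 : EReal) < I.2) ∧
  ∃ (n : ℕ) (I : Fin n → ℝ × EReal), (Finset.univ : Finset (Fin n)).val.map I = B ∧
    Nonempty (M ≅ intervalSum k I)

/-! ### Piecewise linear interpolation -/

/-- The piecewise linear interpolation of the time series, taking the value `x_i` at time `i` for
`1 ≤ i ≤ N`, as a sum of hat functions on its domain `[1, N]`. -/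
def piecewiseLinear {N : ℕ} (τ : Fin N → ℝ) (t : Set.Icc (1 : ℝ) N) : ℝ :=
  ∑ i : Fin N, τ i * max 0 (1 - |t.1 - ((i : ℝ) + 1)|)

/-- Between consecutive sample times the interpolation is linear. -/
theorem piecewiseLinear_segment {N : ℕ} (τ : Fin N → ℝ) (t : Set.Icc (1 : ℝ) N) (i j : Fin N)
    (hij : (j : ℕ) = i + 1) (s : ℝ) (h₀ : 0 ≤ s) (h₁ : s ≤ 1) (ht : t.1 = (i : ℝ) + 1 + s) :
    piecewiseLinear τ t = (1 - s) * τ i + s * τ j := by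
  have hne : i ≠ j := fun h => by subst h; omega
  have hj : (j : ℝ) = i + 1 := by exact_mod_cast hij
  unfold piecewiseLinear
  rw [← Finset.sum_subset (Finset.subset_univ {i, j}), Finset.sum_pair hne]
  · rw [ht, hj, show (i : ℝ) + 1 + s - (i + 1) = s by ring,
      show (i : ℝ) + 1 + s - (i + 1 + 1) = -(1 - s) by ring, abs_neg, abs_of_nonneg h₀,
      abs_of_nonneg (sub_nonneg.2 h₁), max_eq_right (by linarith), max_eq_right (by linarith)]
    ring
  · intro l _ hl
    simp only [Finset.mem_insert, Finset.mem_singleton, not_or] at hl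
    have hl1 : (l : ℕ) ≠ i := fun h => hl.1 (Fin.ext h)
    have hl2 : (l : ℕ) ≠ j := fun h => hl.2 (Fin.ext h)
    rw [max_eq_left, mul_zero]
    rw [ht, sub_nonpos]
    rcases lt_or_gt_of_ne hl1 with h | h
    · have : (l : ℝ) + 1 ≤ i := by exact_mod_cast h
      rw [abs_of_nonneg (by linarith)]
      linarith
    · have h' : (i : ℕ) + 2 ≤ l := by omega
      have : (i : ℝ) + 2 ≤ l := by exact_mod_cast h'
      rw [abs_of_nonpos (by linarith)]
      linarith

end HorizonTree

end

/-!
The components of the sublevel graphs of the weighted path are segments of consecutive vertices, and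
each of them corresponds to the pair of indices just outside it, at which the values are larger than
all those in between: this is a visible pair, and the component appears at the largest value in
between. The tree edge above the component lies on the boundaries of exactly the two regions of that
pair. Hence lengths telescope, and a node of the dual tree has as its height the largest value
strictly between its ends, or zero for the leaves, which have no index in between.

After the leaves are cut, every node is represented by an index at which this largest value is
taken, and two such indices are connected in the sublevel set of the interpolation at `a` exactly
when both lie between the ends of a node of height at most `a`. So the tree is a merge tree of the
interpolation, and suppressing vertices of degree two preserves this, because lowest common
ancestors survive.

For any merge tree, the classes of the leaves alive at `a` are a basis of `H₀`. Subtracting from the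
class of each mortal leaf that of an older one to which it is connected at its death yields another
basis, in which each element is preserved by the structure maps until its death and killed there.
-/

noncomputable section

namespace HorizonTree

open scoped Classical

/-! ### Components of sublevel sets -/

section SameComponent

variable {X : Type*} [TopologicalSpace X] {f : X → ℝ} {a b : ℝ} {x y z : X}

/-- The points `x` and `y` lie in the same connected component of the sublevel set of `f` at `a`,
which entails that both of them belong to this set. -/
def SameComponent (f : X → ℝ) (a : ℝ) (x y : X) : Prop :=
  y ∈ connectedComponentIn {z | f z ≤ a} x

theorem sameComponent_self (h : f x ≤ a) : SameComponent f a x x :=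
  mem_connectedComponentIn h

theorem SameComponent.left_le (h : SameComponent f a x y) : f x ≤ a :=
  connectedComponentIn_nonempty_iff (F := {z | f z ≤ a}).1 ⟨y, h⟩

theorem SameComponent.right_le (h : SameComponent f a x y) : f y ≤ a :=
  connectedComponentIn_subset {z | f z ≤ a} x h

theorem SameComponent.symm (h : SameComponent f a x y) : SameComponent f a y x := by
  unfold SameComponent
  rw [← connectedComponentIn_eq h]
  exact mem_connectedComponentIn h.left_le

theorem SameComponent.trans (hxy : SameComponent f a x y) (hyz : SameComponent f a y z) :
    SameComponent f a x z := by
  unfold SameComponent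
  rwa [connectedComponentIn_eq hxy]

theorem SameComponent.mono (h : SameComponent f a x y) (hab : a ≤ b) : SameComponent f b x y :=
  connectedComponentIn_mono x (fun _ hz => le_trans hz hab) h

theorem sameComponent_iff_mk_eq (hx : f x ≤ a) (hy : f y ≤ a) :
    SameComponent f a x y ↔ ConnectedComponents.mk (⟨x, hx⟩ : {z // f z ≤ a}) =
      ConnectedComponents.mk ⟨y, hy⟩ := by
  rw [eq_comm, ConnectedComponents.coe_eq_coe', SameComponent,
    connectedComponentIn_eq_image (F := {z | f z ≤ a}) hx]
  exact ⟨fun ⟨_, h, hz⟩ => Subtype.ext (a2 := ⟨y, hy⟩) hz ▸ h, fun h => ⟨_, h, rfl⟩⟩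

end SameComponent

/-! ### Bases adapted to a barcode -/

section BarBasis

open CategoryTheory

variable {k : Type*} [Field k] {M : ℝ ⥤ ModuleCat k} {ι κ : Type}
  {I : ι → ℝ × EReal} {e : ∀ (_ : ι) (a : ℝ), M.obj a}

/-- The elements `e l a` form a barcode basis of `M` with bars `I`: for every `a`, those with
`a ∈ I l` are a basis of `M.obj a`, and the structure maps of `M` preserve `e l` from its birth on
and kill it at its death. -/
structure IsBarBasis (M : ℝ ⥤ ModuleCat k) (I : ι → ℝ × EReal) (e : ∀ (_ : ι) (a : ℝ), M.obj a) :
    Prop where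
  map_eq : ∀ (l : ι) {a b : ℝ} (h : a ⟶ b), (I l).1 ≤ a → M.map h (e l a) = e l b
  eq_zero : ∀ (l : ι) (a : ℝ), (I l).2 ≤ a → e l a = 0
  linearIndependent : ∀ a, LinearIndependent k fun l : {l // InBar (I l) a} => e l a
  top_le_span : ∀ a, ⊤ ≤ Submodule.span k (Set.range fun l : {l // InBar (I l) a} => e l a)

theorem IsBarBasis.comp_equiv (he : IsBarBasis M I e) (σ : κ ≃ ι) :
    IsBarBasis M (I ∘ σ) fun l => e (σ l) where
  map_eq l := he.map_eq (σ l)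
  eq_zero l := he.eq_zero (σ l)
  linearIndependent a :=
    (he.linearIndependent a).comp (fun l : {l // InBar (I (σ l)) a} => ⟨σ l, l.2⟩)
      fun _ _ h => Subtype.ext (σ.injective (congrArg Subtype.val h))
  top_le_span a := (he.top_le_span a).trans <| Submodule.span_mono <| by
    rintro _ ⟨l, rfl⟩
    exact ⟨⟨σ.symm l, by simpa using l.2⟩, by simp⟩

section IntervalSumLift

variable [Fintype ι]

/-- The linear map from the sum of the interval modules of `I` at `a` that sends the generator of
the summand of index `l` to `e l`. -/
def intervalSumLift {V : Type*} [AddCommGroup V] [Module k V] (I : ι → ℝ × EReal) (a : ℝ)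
    (e : ι → V) : intervalSumObj k I a →ₗ[k] V :=
  Fintype.linearCombination k e ∘ₗ (intervalSumObj k I a).subtype

theorem intervalSumLift_apply {V : Type*} [AddCommGroup V] [Module k V] {a : ℝ} (e : ι → V)
    (c : intervalSumObj k I a) : intervalSumLift I a e c = ∑ l, c.1 l • e l :=
  rfl

theorem intervalSumLift_bijective {V : Type*} [AddCommGroup V] [Module k V] {a : ℝ} {e : ι → V}
    (hli : LinearIndependent k fun l : {l // InBar (I l) a} => e l)
    (hspan : ⊤ ≤ Submodule.span k (Set.range fun l : {l // InBar (I l) a} => e l)) :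
    Function.Bijective (intervalSumLift (k := k) I a e) := by
  constructor
  · rw [← LinearMap.ker_eq_bot, LinearMap.ker_eq_bot']
    intro c hc
    have hsum : ∑ l : {l // InBar (I l) a}, c.1 l • e l = 0 := by
      rw [← hc, intervalSumLift_apply]
      refine Fintype.sum_of_injective Subtype.val Subtype.val_injective _ _ (fun l hl => ?_)
        fun _ => rfl
      rw [c.2 l fun h => hl ⟨⟨l, h⟩, rfl⟩, zero_smul]
    have hzero := Fintype.linearIndependent_iff.1 hli (fun l => c.1 l) hsum
    ext l
    by_cases hl : InBar (I l) a
    exacts [hzero ⟨l, hl⟩, c.2 l hl]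
  · rw [← LinearMap.range_eq_top, ← top_le_iff]
    refine hspan.trans (Submodule.span_le.2 ?_)
    rintro _ ⟨l, rfl⟩
    refine ⟨⟨Pi.single l 1, fun j hj => Pi.single_eq_of_ne (by rintro rfl; exact hj l.2) _⟩, ?_⟩
    exact Fintype.linearCombination_apply_single k e l.1 1 |>.trans (one_smul k _)

theorem IsBarBasis.map_intervalSumLift (he : IsBarBasis M I e) {a b : ℝ} (h : a ⟶ b)
    (c : intervalSumObj k I a) :
    intervalSumLift I b (e · b) (intervalSumMap k I a b c) =
      M.map h (intervalSumLift I a (e · a) c) := by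
  rw [intervalSumLift_apply, intervalSumLift_apply, map_sum]
  refine Finset.sum_congr rfl fun l _ => ?_
  change (if InBar (I l) b then c.1 l else 0) • e l b = _
  rw [map_smul]
  by_cases ha : InBar (I l) a
  · rw [he.map_eq l h ha.1]
    split_ifs with hb
    · rfl
    · have hdeath : (I l).2 ≤ b := not_lt.1 fun hlt => hb ⟨ha.1.trans (leOfHom h), hlt⟩
      rw [he.eq_zero l b hdeath, smul_zero, smul_zero]
  · simp only [c.2 l ha, ite_self, zero_smul]

end IntervalSumLift

theorem IsBarBasis.nonempty_iso [Finite ι] (he : IsBarBasis M I e) :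
    Nonempty (M ≅ intervalSum k I) := by
  let := Fintype.ofFinite ι
  let equiv (a : ℝ) : intervalSumObj k I a ≃ₗ[k] M.obj a :=
    LinearEquiv.ofBijective (intervalSumLift I a (e · a))
      (intervalSumLift_bijective (he.linearIndependent a) (he.top_le_span a))
  refine ⟨(NatIso.ofComponents (fun a => (equiv a).toModuleIso) fun h => ?_).symm⟩
  exact ModuleCat.hom_ext (LinearMap.ext (he.map_intervalSumLift h))

theorem IsBarBasis.isBarcode [Fintype ι] (he : IsBarBasis M I e)
    (hI : ∀ l, ((I l).1 : EReal) < (I l).2) :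
    IsBarcode M (Finset.univ.val.map I) := by
  let σ := (Fintype.equivFin ι).symm
  refine ⟨Multiset.forall_mem_map_iff.2 fun l _ => hI l, Fintype.card ι, I ∘ σ, ?_,
    (he.comp_equiv σ).nonempty_iso⟩
  rw [← Multiset.map_map]
  exact congrArg (Multiset.map I) (congrArg Finset.val (Finset.map_univ_equiv σ))

end BarBasis

/-! ### The Elder Rule in zeroth homology -/

section ElderRule

open CategoryTheory

variable {k : Type*} [Field k] {X : Type} [TopologicalSpace X] {f : X → ℝ} {a b : ℝ} {x y : X}

variable (k f) in
/-- The class of the point `x` in `H₀` of the sublevel set of `f` at `a`, and zero when `x` does not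
belong to this set. -/
def pointClass (x : X) (a : ℝ) : (sublevelH0 k f).obj a :=
  (if h : f x ≤ a then Finsupp.single (ConnectedComponents.mk ⟨x, h⟩) 1 else 0 :
    ConnectedComponents {z // f z ≤ a} →₀ k)

theorem pointClass_of_le (h : f x ≤ a) :
    pointClass k f x a = Finsupp.single (ConnectedComponents.mk ⟨x, h⟩) (1 : k) :=
  dif_pos h

theorem map_pointClass (h : f x ≤ a) (hab : a ⟶ b) :
    (sublevelH0 k f).map hab (pointClass k f x a) = pointClass k f x b := by
  rw [pointClass_of_le h, pointClass_of_le (h.trans (leOfHom hab))]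
  exact Finsupp.mapDomain_single

theorem SameComponent.pointClass_eq (h : SameComponent f a x y) :
    pointClass k f x a = pointClass k f y a := by
  rw [pointClass_of_le h.left_le, pointClass_of_le h.right_le,
    (sameComponent_iff_mk_eq h.left_le h.right_le).1 h]

theorem span_range_pointClass (a : ℝ) :
    Submodule.span k (Set.range fun x : {x // f x ≤ a} => pointClass k f x.1 a) = ⊤ := by
  refine top_le_iff.1 fun z _ => ?_
  induction z using Finsupp.induction_linear with
  | zero => exact zero_mem _
  | add y z hy hz => exact add_mem (hy trivial) (hz trivial)
  | single c s =>
    obtain ⟨x, rfl⟩ := ConnectedComponents.surjective_coe c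
    have hsingle : s • pointClass k f x.1 a = Finsupp.single (ConnectedComponents.mk x) s :=
      (congrArg (s • ·) (pointClass_of_le x.2)).trans (Finsupp.smul_single_one _ s)
    exact hsingle ▸ Submodule.smul_mem _ s (Submodule.subset_span ⟨x, rfl⟩)

/-- The points `pt l` generate `H₀` of the sublevel sets of `f`, and `death l` is the first level at
which `pt l` is connected to the point of an older index. -/
structure IsElderRule {ι : Type} (f : X → ℝ) (older : ι → ι → Prop) (pt : ι → X)
    (death : ι → EReal) : Prop where
  birth_mono : ∀ {l l' : ι}, older l' l → f (pt l') ≤ f (pt l)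
  cover : ∀ {x : X} {a : ℝ}, f x ≤ a → ∃ l, SameComponent f a x (pt l)
  death_le_iff : ∀ {l : ι} {a : ℝ},
    death l ≤ a ↔ ∃ l', older l' l ∧ SameComponent f a (pt l) (pt l')
  birth_lt_death : ∀ l, (f (pt l) : EReal) < death l

namespace IsElderRule

variable {ι : Type} {older : ι → ι → Prop} {pt : ι → X} {death : ι → EReal} {l : ι}

theorem exists_elder (h : IsElderRule f older pt death) (hl : death l ≠ ⊤) :
    ∃ l', older l' l ∧ ∀ a : ℝ, death l ≤ a → SameComponent f a (pt l) (pt l') := by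
  lift death l to ℝ using ⟨hl, ((EReal.bot_lt_coe _).trans (h.birth_lt_death l)).ne'⟩ with d hd
  obtain ⟨l', hold, hsame⟩ := h.death_le_iff.1 hd.ge
  exact ⟨l', hold, fun a ha => hsame.mono (EReal.coe_le_coe_iff.1 ha)⟩

/-- An index older than `l` whose point is connected to that of `l` from the death of `l` on; the
value when `l` does not die is irrelevant. -/
def elder (h : IsElderRule f older pt death) (l : ι) : ι :=
  if hl : death l ≠ ⊤ then (h.exists_elder hl).choose else l

theorem older_elder (h : IsElderRule f older pt death) (hl : death l ≠ ⊤) :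
    older (h.elder l) l := by
  rw [elder, dif_pos hl]
  exact (h.exists_elder hl).choose_spec.1

theorem sameComponent_elder (h : IsElderRule f older pt death) (hl : death l ≤ a) :
    SameComponent f a (pt l) (pt (h.elder l)) := by
  have hl' : death l ≠ ⊤ := (hl.trans_lt (EReal.coe_lt_top a)).ne
  rw [elder, dif_pos hl']
  exact (h.exists_elder hl').choose_spec.2 a hl

variable (k) in
/-- The homology class that generates the bar of `l`: the class of the point of `l`, minus that of
its elder unless `l` never dies. -/
def barClass (h : IsElderRule f older pt death) (l : ι) (a : ℝ) : (sublevelH0 k f).obj a :=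
  pointClass k f (pt l) a - if death l = ⊤ then 0 else pointClass k f (pt (h.elder l)) a

theorem barClass_eq_zero (h : IsElderRule f older pt death) (hl : death l ≤ a) :
    h.barClass k l a = 0 := by
  have hl' : death l ≠ ⊤ := (hl.trans_lt (EReal.coe_lt_top a)).ne
  rw [barClass, if_neg hl', (h.sameComponent_elder hl).pointClass_eq, sub_self]

theorem map_barClass (h : IsElderRule f older pt death) (hl : f (pt l) ≤ a) (hab : a ⟶ b) :
    (sublevelH0 k f).map hab (h.barClass k l a) = h.barClass k l b := by
  unfold barClass
  rw [map_sub, map_pointClass hl]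
  split_ifs with hd
  · rw [map_zero]
  · rw [map_pointClass ((h.birth_mono (h.older_elder hd)).trans hl)]

variable [IsStrictTotalOrder ι older]

section Finite

variable [Finite ι]

theorem pointClass_mem_span_barClass (h : IsElderRule f older pt death) (hl : f (pt l) ≤ a) :
    pointClass k f (pt l) a ∈ Submodule.span k
      (Set.range fun l : {l // InBar (f (pt l), death l) a} => h.barClass k l a) := by
  induction l using (Finite.wellFounded_of_trans_of_irrefl older).induction with
  | _ l ih =>
    by_cases hdead : death l ≤ a
    · have hsame := h.sameComponent_elder hdead
      rw [hsame.pointClass_eq]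
      exact ih _ (h.older_elder (hdead.trans_lt (EReal.coe_lt_top a)).ne) hsame.right_le
    · have hbar : h.barClass k l a ∈ Submodule.span k
          (Set.range fun l : {l // InBar (f (pt l), death l) a} => h.barClass k l a) :=
        Submodule.subset_span ⟨⟨l, hl, not_le.1 hdead⟩, rfl⟩
      unfold barClass at hbar ⊢
      split_ifs at hbar with htop
      · simpa only [sub_zero] using hbar
      · have hold := h.older_elder htop
        simpa only [sub_add_cancel] using
          add_mem hbar (ih _ hold ((h.birth_mono hold).trans hl))

theorem top_le_span_barClass (h : IsElderRule f older pt death) (a : ℝ) :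
    ⊤ ≤ Submodule.span k
      (Set.range fun l : {l // InBar (f (pt l), death l) a} => h.barClass k l a) := by
  rw [← span_range_pointClass (k := k) (f := f) a, Submodule.span_le]
  rintro _ ⟨x, rfl⟩
  obtain ⟨l, hl⟩ := h.cover x.2
  change pointClass k f x.1 a ∈ _
  rw [hl.pointClass_eq]
  exact h.pointClass_mem_span_barClass hl.right_le

theorem mk_point_bijective (h : IsElderRule f older pt death) (a : ℝ) :
    Function.Bijective fun l : {l // InBar (f (pt l), death l) a} =>
      ConnectedComponents.mk (⟨pt l, l.2.1⟩ : {x // f x ≤ a}) := by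
  constructor
  · intro l l' heq
    have hsame : SameComponent f a (pt l) (pt l') := (sameComponent_iff_mk_eq _ _).2 heq
    rcases trichotomous_of older l.1 l'.1 with hold | heq | hold
    · exact absurd (h.death_le_iff.2 ⟨l, hold, hsame.symm⟩) l'.2.2.not_ge
    · exact Subtype.ext heq
    · exact absurd (h.death_le_iff.2 ⟨l', hold, hsame⟩) l.2.2.not_ge
  · intro c
    obtain ⟨⟨x, hx⟩, rfl⟩ := ConnectedComponents.surjective_coe c
    obtain ⟨l, hxl, hmin⟩ := (Finite.wellFounded_of_trans_of_irrefl older).has_min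
      {l | SameComponent f a x (pt l)} (h.cover hx)
    have halive : ¬ death l ≤ a := fun hdead => by
      obtain ⟨l', hold, hsame⟩ := h.death_le_iff.1 hdead
      exact hmin l' (hxl.trans hsame) hold
    exact ⟨⟨l, hxl.right_le, not_le.1 halive⟩,
      ((sameComponent_iff_mk_eq hx hxl.right_le).1 hxl).symm⟩

theorem linearIndependent_barClass (h : IsElderRule f older pt death) (a : ℝ) :
    LinearIndependent k fun l : {l // InBar (f (pt l), death l) a} => h.barClass k l a := by
  let := Fintype.ofFinite ι
  refine linearIndependent_of_top_le_span_of_card_eq_finrank (h.top_le_span_barClass a) ?_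
  have hbij := h.mk_point_bijective a
  let := Fintype.ofBijective _ hbij
  rw [Fintype.card_of_bijective hbij]
  exact (Module.finrank_finsupp_self k).symm

theorem isBarBasis_barClass (h : IsElderRule f older pt death) :
    IsBarBasis (sublevelH0 k f) (fun l => (f (pt l), death l)) (h.barClass k) where
  map_eq _ _ _ hab hl := h.map_barClass hl hab
  eq_zero _ _ hl := h.barClass_eq_zero hl
  linearIndependent := h.linearIndependent_barClass
  top_le_span := h.top_le_span_barClass

end Finite

theorem isBarcode [Fintype ι] (h : IsElderRule f older pt death) :
    IsBarcode (sublevelH0 k f) (Finset.univ.val.map fun l => (f (pt l), death l)) :=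
  h.isBarBasis_barClass.isBarcode h.birth_lt_death

end IsElderRule

end ElderRule

/-! ### Pruned merge trees -/

section Pruning

variable {α : Type} [PartialOrder α] {S : Set α} {l u v w : α}

theorem IsLeaf.mem_suppressDegreeTwo (hl : IsLeaf S l) : l ∈ suppressDegreeTwo S :=
  ⟨hl.1, fun ⟨_, hc, _⟩ => hc.2.2.1.not_ge (hl.2 hc.1 hc.2.2.1.le)⟩

variable [Finite α]

theorem exists_isLeaf_le (hv : v ∈ S) : ∃ l, IsLeaf S l ∧ l ≤ v := by
  obtain ⟨l, hl, h⟩ := (Set.toFinite S).exists_le_minimal hv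
  exact ⟨l, h, hl⟩

theorem exists_isChild_ge (hl : l ∈ S) (hv : v ∈ S) (h : l < v) : ∃ c, IsChild S c v ∧ l ≤ c := by
  obtain ⟨c, hlc, hc⟩ := (Set.toFinite {c | c ∈ S ∧ c < v}).exists_le_maximal ⟨hl, h⟩
  exact ⟨c, ⟨hc.1.1, hv, hc.1.2, fun d hd hcd hdv => hcd.not_ge (hc.2 ⟨hd, hdv⟩ hcd.le)⟩, hlc⟩

/-- A lowest common ancestor of two incomparable nodes has two distinct children. -/
theorem exists_common_ancestor_suppressDegreeTwo (hv : v ∈ suppressDegreeTwo S)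
    (hw : w ∈ suppressDegreeTwo S) (hu : u ∈ S) (hvu : v ≤ u) (hwu : w ≤ u) :
    ∃ u' ∈ suppressDegreeTwo S, v ≤ u' ∧ w ≤ u' ∧ u' ≤ u := by
  by_cases hvw : v ≤ w
  · exact ⟨w, hw, hvw, le_rfl, hwu⟩
  by_cases hwv : w ≤ v
  · exact ⟨v, hv, le_rfl, hwv, hvu⟩
  obtain ⟨m, hmu, ⟨hm, hvm, hwm⟩, hmin⟩ :=
    (Set.toFinite {m | m ∈ S ∧ v ≤ m ∧ w ≤ m}).exists_le_minimal ⟨hu, hvu, hwu⟩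
  refine ⟨m, ⟨hm, ?_⟩, hvm, hwm, hmu⟩
  rintro ⟨c, -, huniq⟩
  obtain ⟨d, hd, hvd⟩ := exists_isChild_ge hv.1 hm (hvm.lt_of_ne fun h => hwv (h ▸ hwm))
  obtain ⟨d', hd', hwd'⟩ := exists_isChild_ge hw.1 hm (hwm.lt_of_ne fun h => hvw (h ▸ hvm))
  obtain rfl : d = d' := (huniq d hd).trans (huniq d' hd').symm
  exact hd.2.2.1.not_ge (hmin ⟨hd.1, hvd, hwd'⟩ hd.2.2.1.le)

end Pruning

namespace HeightTree

theorem older_isStrictTotalOrder {α : Type} (T : HeightTree α) (tie : α → α → Prop)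
    [IsStrictTotalOrder α tie] : IsStrictTotalOrder α (T.Older tie) where
  irrefl := by
    rintro l (h | h)
    · exact h.false
    · exact irrefl_of tie l h.2
  trans := by
    rintro l₁ l₂ l₃ (h | ⟨h, ht⟩) (h' | ⟨h', ht'⟩)
    · exact Or.inl (h.trans h')
    · exact Or.inl (h.trans_eq h')
    · exact Or.inl (h.trans_lt h')
    · exact Or.inr ⟨h.trans h', _root_.trans ht ht'⟩
  trichotomous := by
    intro l₁ l₂ h₁ h₂
    simp only [Older, not_or, not_and, not_lt] at h₁ h₂
    have h := le_antisymm h₂.1 h₁.1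
    rcases trichotomous_of tie l₁ l₂ with ht | ht | ht
    · exact absurd ht (h₁.2 h)
    · exact ht
    · exact absurd ht (h₂.2 h.symm)

theorem Older.height_le {α : Type} {T : HeightTree α} {tie : α → α → Prop} {l l' : α}
    (h : T.Older tie l' l) : T.height l' ≤ T.height l :=
  h.elim le_of_lt fun h => h.1.le

variable {α : Type} [PartialOrder α] {T : HeightTree α} {tie : α → α → Prop} {l : α}

theorem elderRule_eq_map_leaves [Fintype α] (T : HeightTree α) (tie : α → α → Prop) :
    T.elderRule tie = (Finset.univ : Finset {l : α // IsLeaf T.nodes l}).val.map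
      fun l => (T.height l.1, T.death tie l.1) := by
  rw [elderRule, ← Finset.univ_val_map_subtype_val, Multiset.map_map]
  rfl

theorem exists_death_eq [Finite α] (h : T.death tie l ≠ ⊤) :
    ∃ v ∈ T.nodes, l ≤ v ∧ (∃ l', IsLeaf T.nodes l' ∧ l' ≤ v ∧ T.Older tie l' l) ∧
      T.death tie l = (T.height v : EReal) := by
  refine Set.Nonempty.csInf_mem (s := {d : EReal | ∃ v ∈ T.nodes, l ≤ v ∧
    (∃ l', IsLeaf T.nodes l' ∧ l' ≤ v ∧ T.Older tie l' l) ∧ d = (T.height v : EReal)}) ?_ ?_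
  · refine Set.nonempty_iff_ne_empty.2 fun hempty => h ?_
    rw [death, hempty, sInf_empty]
  · refine (Set.finite_range fun v => (T.height v : EReal)).subset ?_
    rintro _ ⟨v, -, -, -, rfl⟩
    exact ⟨v, rfl⟩

/-- `T` is a merge tree of the sublevel sets of `f`: every component of a sublevel set contains one
of the points `pt v`, and two of these points are connected in the sublevel set at `a` exactly when
their nodes have a common ancestor of height at most `a`. -/
structure IsMergeTreeOf {X : Type} [TopologicalSpace X] (T : HeightTree α) (f : X → ℝ)
    (pt : T.nodes → X) : Prop where
  strictMonoOn : StrictMonoOn T.height T.nodes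
  cover : ∀ {x : X} {a : ℝ}, f x ≤ a → ∃ v, SameComponent f a x (pt v)
  sameComponent_iff : ∀ {v w : T.nodes} {a : ℝ}, SameComponent f a (pt v) (pt w) ↔
    ∃ u ∈ T.nodes, v.1 ≤ u ∧ w.1 ≤ u ∧ T.height u ≤ a

namespace IsMergeTreeOf

variable {X : Type} [TopologicalSpace X] {f : X → ℝ} {pt : T.nodes → X}

theorem apply_eq_height (h : T.IsMergeTreeOf f pt) (v : T.nodes) : f (pt v) = T.height v := by
  refine eq_of_forall_ge_iff fun a => ⟨fun ha => ?_, fun ha => ?_⟩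
  · obtain ⟨u, hu, hvu, -, hua⟩ := h.sameComponent_iff.1 (sameComponent_self ha)
    exact (h.strictMonoOn.monotoneOn v.2 hu hvu).trans hua
  · exact (h.sameComponent_iff.2 ⟨v, v.2, le_rfl, le_rfl, ha⟩).left_le

theorem exists_isLeaf_sameComponent [Finite α] (h : T.IsMergeTreeOf f pt) {x : X} {a : ℝ}
    (hx : f x ≤ a) : ∃ l, ∃ hl : IsLeaf T.nodes l, SameComponent f a x (pt ⟨l, hl.1⟩) := by
  obtain ⟨v, hv⟩ := h.cover hx
  obtain ⟨l, hl, hlv⟩ := exists_isLeaf_le v.2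
  refine ⟨l, hl, hv.trans (h.sameComponent_iff.2 ⟨v, v.2, le_rfl, hlv, ?_⟩)⟩
  exact (h.apply_eq_height v).symm.trans_le hv.right_le

theorem suppressDegreeTwo [Finite α] (h : T.IsMergeTreeOf f pt) :
    (⟨HorizonTree.suppressDegreeTwo T.nodes, T.height⟩ : HeightTree α).IsMergeTreeOf f
      (pt ∘ Set.inclusion (Set.sep_subset _ _)) where
  strictMonoOn := h.strictMonoOn.mono (Set.sep_subset _ _)
  cover hx := by
    obtain ⟨l, hl, hxl⟩ := h.exists_isLeaf_sameComponent hx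
    exact ⟨⟨l, hl.mem_suppressDegreeTwo⟩, hxl⟩
  sameComponent_iff {v w a} := by
    refine h.sameComponent_iff.trans ⟨fun ⟨u, hu, hvu, hwu, hua⟩ => ?_,
      fun ⟨u, hu, hu'⟩ => ⟨u, hu.1, hu'⟩⟩
    obtain ⟨u', hu', hvu', hwu', hle⟩ :=
      exists_common_ancestor_suppressDegreeTwo v.2 w.2 hu hvu hwu
    exact ⟨u', hu', hvu', hwu', (h.strictMonoOn.monotoneOn hu'.1 hu hle).trans hua⟩

theorem isElderRule [Finite α] [IsStrictTotalOrder α tie] (h : T.IsMergeTreeOf f pt) :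
    IsElderRule f (Order.Preimage Subtype.val (T.Older tie))
      (fun l : {l // IsLeaf T.nodes l} => pt ⟨l, l.2.1⟩) fun l => T.death tie l where
  birth_mono hold := by
    rw [h.apply_eq_height, h.apply_eq_height]
    exact Older.height_le hold
  cover hx := by
    obtain ⟨l, hl, hxl⟩ := h.exists_isLeaf_sameComponent hx
    exact ⟨⟨l, hl⟩, hxl⟩
  death_le_iff {l a} := by
    constructor
    · intro hdeath
      obtain ⟨v, hv, hlv, ⟨l', hl', hlv', hold⟩, heq⟩ :=
        exists_death_eq (hdeath.trans_lt (EReal.coe_lt_top a)).ne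
      rw [heq, EReal.coe_le_coe_iff] at hdeath
      exact ⟨⟨l', hl'⟩, hold, h.sameComponent_iff.2 ⟨v, hv, hlv, hlv', hdeath⟩⟩
    · rintro ⟨l', hold, hsame⟩
      obtain ⟨v, hv, hlv, hlv', hva⟩ := h.sameComponent_iff.1 hsame
      exact (sInf_le ⟨v, hv, hlv, ⟨l', l'.2, hlv', hold⟩, rfl⟩ : T.death tie l ≤ T.height v).trans
        (EReal.coe_le_coe_iff.2 hva)
  birth_lt_death l := by
    have := T.older_isStrictTotalOrder tie
    rw [h.apply_eq_height]
    by_cases hdeath : T.death tie l = ⊤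
    · rw [hdeath]
      exact EReal.coe_lt_top _
    · obtain ⟨v, hv, hlv, ⟨l', hl', hlv', hold⟩, heq⟩ := exists_death_eq hdeath
      rw [heq, EReal.coe_lt_coe_iff]
      refine h.strictMonoOn l.2.1 hv (hlv.lt_of_ne ?_)
      rintro rfl
      rw [l.2.eq_of_le hl'.1 hlv'] at hold
      exact irrefl_of (T.Older tie) _ hold

theorem isBarcode_elderRule [Fintype α] [IsStrictTotalOrder α tie] (h : T.IsMergeTreeOf f pt)
    (k : Type*) [Field k] : IsBarcode (sublevelH0 k f) (T.elderRule tie) := by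
  have := T.older_isStrictTotalOrder tie
  have : IsStrictTotalOrder {l // IsLeaf T.nodes l} (Order.Preimage Subtype.val (T.Older tie)) :=
    (RelEmbedding.preimage (Function.Embedding.subtype _) _).isStrictTotalOrder
  rw [elderRule_eq_map_leaves]
  simpa only [h.apply_eq_height] using (h.isElderRule (tie := tie)).isBarcode (k := k)

end IsMergeTreeOf

end HeightTree

/-! ### Sublevel sets of the piecewise linear interpolation -/

theorem sameComponent_iff_forall_mem_Icc {S : Set ℝ} [S.OrdConnected] {f : S → ℝ} {a : ℝ}
    {s t : S} (hst : s ≤ t) : SameComponent f a s t ↔ ∀ u ∈ Set.Icc s t, f u ≤ a := by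
  constructor
  · intro h u hu
    have hIcc := (isPreconnected_connectedComponentIn.image Subtype.val
      continuous_subtype_val.continuousOn).Icc_subset
      (Set.mem_image_of_mem _ (mem_connectedComponentIn (F := {z | f z ≤ a}) h.left_le))
      (Set.mem_image_of_mem _ h)
    obtain ⟨v, hv, hvu⟩ := hIcc ⟨hu.1, hu.2⟩
    exact Subtype.ext hvu ▸ connectedComponentIn_subset {z | f z ≤ a} s hv
  · intro h
    have hpre : IsPreconnected (Set.Icc s t) := by
      rw [← Topology.IsInducing.subtypeVal.isPreconnected_image, Set.image_subtype_val_Icc]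
      exact isPreconnected_Icc
    exact hpre.subset_connectedComponentIn (Set.left_mem_Icc.2 hst) h (Set.right_mem_Icc.2 hst)

section PiecewiseLinear

variable {N : ℕ} {τ : Fin N → ℝ} {a : ℝ} {i j l m : Fin N} {s t u : Set.Icc (1 : ℝ) N}

/-- The time `i + 1` at which the interpolation takes the value `τ i`. -/
def sampleTime (i : Fin N) : Set.Icc (1 : ℝ) N :=
  ⟨(i : ℝ) + 1, by simp, by exact_mod_cast i.2⟩

theorem sampleTime_strictMono : StrictMono (sampleTime (N := N)) := fun i j hij => by
  have : (i : ℝ) < j := by exact_mod_cast hij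
  exact Subtype.coe_lt_coe.1 (by simpa [sampleTime] using this)

theorem piecewiseLinear_sampleTime (i : Fin N) : piecewiseLinear τ (sampleTime i) = τ i := by
  unfold piecewiseLinear
  rw [Finset.sum_eq_single i]
  · simp [sampleTime]
  · intro j _ hj
    rw [max_eq_left, mul_zero]
    have h : (i : ℤ) - j ≠ 0 := sub_ne_zero.2 fun h => hj (Fin.ext (by exact_mod_cast h.symm))
    have : (1 : ℝ) ≤ |(i : ℝ) - j| := by exact_mod_cast Int.one_le_abs h
    simpa [sampleTime] using this
  · simp

theorem eq_sampleTime_or_mem_Ioo (t : Set.Icc (1 : ℝ) N) :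
    (∃ i, t = sampleTime i) ∨
      ∃ i j : Fin N, (j : ℕ) = i + 1 ∧ t ∈ Set.Ioo (sampleTime i) (sampleTime j) := by
  have hpos : 1 ≤ ⌊t.1⌋₊ := Nat.le_floor (by simpa using t.2.1)
  have hfloor : (⌊t.1⌋₊ : ℝ) ≤ t.1 := Nat.floor_le (by linarith [t.2.1])
  have hN : ⌊t.1⌋₊ ≤ N := by exact_mod_cast hfloor.trans t.2.2
  let i : Fin N := ⟨⌊t.1⌋₊ - 1, by omega⟩
  have hi : (sampleTime i : ℝ) = ⌊t.1⌋₊ := by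
    change ((⌊t.1⌋₊ - 1 : ℕ) : ℝ) + 1 = _
    exact_mod_cast Nat.sub_add_cancel hpos
  rcases hfloor.eq_or_lt with heq | hlt
  · exact Or.inl ⟨i, Subtype.ext (heq.symm.trans hi.symm)⟩
  · have hlt' : ⌊t.1⌋₊ < N := by exact_mod_cast hlt.trans_le t.2.2
    refine Or.inr ⟨i, ⟨⌊t.1⌋₊, hlt'⟩, by simp [i]; omega, ?_, Nat.lt_floor_add_one t.1⟩
    exact Subtype.coe_lt_coe.1 (hi.trans_lt hlt)

theorem piecewiseLinear_of_mem_Icc (hij : (j : ℕ) = i + 1)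
    (ht : t ∈ Set.Icc (sampleTime i) (sampleTime j)) :
    piecewiseLinear τ t = τ i + (t.1 - (i + 1)) * (τ j - τ i) := by
  have hj : (j : ℝ) = i + 1 := by exact_mod_cast hij
  have hit : (i : ℝ) + 1 ≤ t := ht.1
  have htj : (t : ℝ) ≤ j + 1 := ht.2
  rw [piecewiseLinear_segment τ t i j hij (t.1 - (i + 1)) (by linarith) (by linarith) (by ring)]
  ring

theorem sameComponent_of_mem_Icc_sampleTime (hij : (j : ℕ) = i + 1) (his : sampleTime i ≤ s)
    (hst : s ≤ t) (htj : t ≤ sampleTime j) (hs : piecewiseLinear τ s ≤ a)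
    (ht : piecewiseLinear τ t ≤ a) : SameComponent (piecewiseLinear τ) a s t := by
  refine (sameComponent_iff_forall_mem_Icc hst).2 fun u ⟨hsu, hut⟩ => ?_
  rw [piecewiseLinear_of_mem_Icc hij ⟨his.trans hsu, hut.trans htj⟩]
  rw [piecewiseLinear_of_mem_Icc hij ⟨his, hst.trans htj⟩] at hs
  rw [piecewiseLinear_of_mem_Icc hij ⟨his.trans hst, htj⟩] at ht
  have hsu : (s : ℝ) ≤ u := hsu
  have hut : (u : ℝ) ≤ t := hut
  rcases le_total (τ i) (τ j) with h | h <;> nlinarith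

theorem sameComponent_sampleTime_iff (hlm : l ≤ m) :
    SameComponent (piecewiseLinear τ) a (sampleTime l) (sampleTime m) ↔
      ∀ j, l ≤ j → j ≤ m → τ j ≤ a := by
  have hmono := (sampleTime_strictMono (N := N)).monotone
  rw [sameComponent_iff_forall_mem_Icc (hmono hlm)]
  constructor
  · intro h j hlj hjm
    exact (piecewiseLinear_sampleTime j).symm.trans_le (h _ ⟨hmono hlj, hmono hjm⟩)
  · rintro h u ⟨hlu, hum⟩
    rcases eq_sampleTime_or_mem_Ioo u with ⟨i, rfl⟩ | ⟨i, j, hij, hiu, huj⟩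
    · rw [piecewiseLinear_sampleTime]
      exact h i (sampleTime_strictMono.le_iff_le.1 hlu) (sampleTime_strictMono.le_iff_le.1 hum)
    · have hlj : l < j := sampleTime_strictMono.lt_iff_lt.1 (hlu.trans_lt huj)
      have him : i < m := sampleTime_strictMono.lt_iff_lt.1 (hiu.trans_le hum)
      have hi : τ i ≤ a := h i (Fin.le_def.2 (by omega)) him.le
      have hj : τ j ≤ a := h j hlj.le (Fin.le_def.2 (by omega))
      have hsame := sameComponent_of_mem_Icc_sampleTime hij le_rfl (hiu.trans huj).le le_rfl
        ((piecewiseLinear_sampleTime i).trans_le hi) ((piecewiseLinear_sampleTime j).trans_le hj)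
      exact (sameComponent_iff_forall_mem_Icc (hiu.trans huj).le).1 hsame u ⟨hiu.le, huj.le⟩

theorem exists_sameComponent_sampleTime (ht : piecewiseLinear τ t ≤ a) :
    ∃ i, SameComponent (piecewiseLinear τ) a t (sampleTime i) := by
  rcases eq_sampleTime_or_mem_Ioo t with ⟨i, rfl⟩ | ⟨i, j, hij, hit, htj⟩
  · exact ⟨i, sameComponent_self ht⟩
  have hval := piecewiseLinear_of_mem_Icc (τ := τ) hij ⟨hit.le, htj.le⟩
  have hj : (j : ℝ) = i + 1 := by exact_mod_cast hij
  have hit' : (i : ℝ) + 1 < t := hit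
  have htj' : (t : ℝ) < j + 1 := htj
  rcases le_total (τ i) (τ j) with h | h
  · have hi : piecewiseLinear τ (sampleTime i) ≤ a := by
      rw [piecewiseLinear_sampleTime]
      nlinarith
    exact ⟨i, (sameComponent_of_mem_Icc_sampleTime hij le_rfl hit.le htj.le hi ht).symm⟩
  · have hj : piecewiseLinear τ (sampleTime j) ≤ a := by
      rw [piecewiseLinear_sampleTime]
      nlinarith
    exact ⟨j, sameComponent_of_mem_Icc_sampleTime hij hit.le htj.le le_rfl ht hj⟩

end PiecewiseLinear

/-! ### Heights from edge lengths -/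

section HeightOfLengths

variable {α : Type} [PartialOrder α] [Fintype α] {S : Set α} {h len : α → ℝ} {l v : α}

theorem sum_lengths_eq_sub
    (hS : ∀ w ∈ S, ∀ u ∈ S, w < u → ∃ v, IsLeast {u ∈ S | w < u} v ∧ len w = h v - h w)
    (hl : l ∈ S) (hv : v ∈ S) (hlv : l ≤ v) :
    ∑ w : α with w ∈ S ∧ l ≤ w ∧ w < v, len w = h v - h l := by
  induction l using (wellFounded_gt (α := α)).induction with
  | _ l ih =>
    rcases hlv.eq_or_lt with rfl | hlt
    · rw [Finset.filter_false_of_mem, Finset.sum_empty, sub_self]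
      exact fun w _ hw => (hw.2.1.trans_lt hw.2.2).false
    · obtain ⟨c, ⟨⟨hc, hlc⟩, hmin⟩, hlen⟩ := hS l hl v hv hlt
      have hinsert : (Finset.univ.filter fun w : α => w ∈ S ∧ l ≤ w ∧ w < v) =
          insert l (Finset.univ.filter fun w : α => w ∈ S ∧ c ≤ w ∧ w < v) := by
        ext w
        simp only [Finset.mem_filter, Finset.mem_univ, true_and, Finset.mem_insert]
        constructor
        · rintro ⟨hw, hlw, hwv⟩
          exact hlw.eq_or_lt.imp Eq.symm fun hlw => ⟨hw, hmin ⟨hw, hlw⟩, hwv⟩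
        · rintro (rfl | ⟨hw, hcw, hwv⟩)
          exacts [⟨hl, le_rfl, hlt⟩, ⟨hw, hlc.le.trans hcw, hwv⟩]
      rw [hinsert, Finset.sum_insert (by simpa using fun _ h => absurd h hlc.not_ge),
        ih c hlc hc (hmin ⟨hv, hlt⟩), hlen]
      ring

theorem heightOfLengths_eq
    (hS : ∀ w ∈ S, ∀ u ∈ S, w < u → ∃ v, IsLeast {u ∈ S | w < u} v ∧ len w = h v - h w)
    (hleaf : ∀ l, IsLeaf S l → h l = 0) (hv : v ∈ S) : heightOfLengths S len v = h v := by
  have hsum : ∀ l : {l : α // IsLeaf S l ∧ l ≤ v},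
      ∑ w : α with w ∈ S ∧ l.1 ≤ w ∧ w < v, len w = h v := fun ⟨l, hl, hlv⟩ => by
    rw [sum_lengths_eq_sub hS hl.1 hv hlv, hleaf l hl, sub_zero]
  obtain ⟨l, hl, hlv⟩ := exists_isLeaf_le hv
  have : Nonempty {l : α // IsLeaf S l ∧ l ≤ v} := ⟨⟨l, hl, hlv⟩⟩
  simp_rw [heightOfLengths, hsum]
  exact ciSup_const

end HeightOfLengths

/-! ### Visible pairs -/

section VisiblePairs

/-- Pairs of indices of the sequence `(∞, x₁, …, x_N, ∞)`, as in `dualTree` ordered by inclusion of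
the intervals that they span. -/
abbrev IndexPair (N : ℕ) := (Fin (N + 2))ᵒᵈ × Fin (N + 2)

/-- The left end of a pair. -/
abbrev IndexPair.lo {N : ℕ} (p : IndexPair N) : Fin (N + 2) := OrderDual.ofDual p.1

/-- The right end of a pair. -/
abbrev IndexPair.hi {N : ℕ} (p : IndexPair N) : Fin (N + 2) := p.2

/-- The pair with ends `i` and `j`. -/
abbrev indexPair {N : ℕ} (i j : Fin (N + 2)) : IndexPair N := (OrderDual.toDual i, j)

open IndexPair

variable {N : ℕ} {τ : Fin N → ℝ} {p q u v w : IndexPair N} {l : Fin N} {m : Fin (N + 2)} {a : ℝ}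

/-- The time `l` lies strictly between the ends of `p`; its index in `(∞, x₁, …, x_N, ∞)` is
`l.castSucc.succ`. -/
def IsInner (p : IndexPair N) (l : Fin N) : Prop :=
  lo p < l.castSucc.succ ∧ l.castSucc.succ < hi p

/-- The largest value strictly between the ends of a pair, or zero if there is none. -/
def innerMax (τ : Fin N → ℝ) (p : IndexPair N) : ℝ :=
  ⨆ l : {l // IsInner p l}, τ l

/-- The edges of the horizon visibility graph, which are the nodes of its dual tree. -/
def visiblePairs (τ : Fin N → ℝ) : Set (IndexPair N) :=
  {p | lo p < hi p ∧ (horizonVisibilityGraph τ).Adj (lo p) (hi p)}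

/-- The open interval spanned by `p` is a maximal one on which the values are at most `a`. -/
structure IsLevelPair (τ : Fin N → ℝ) (a : ℝ) (p : IndexPair N) : Prop where
  lo_lt_hi : lo p < hi p
  lt_lo : a < withHorizons τ (lo p)
  lt_hi : a < withHorizons τ (hi p)
  innerMax_le : innerMax τ p ≤ a

theorem lo_lt_hi_of_le (hw : lo w < hi w) (hu : w ≤ u) (hv : w ≤ v) : lo u < hi v :=
  (show lo u ≤ lo w from hu.1).trans_lt (hw.trans_le (show hi w ≤ hi v from hv.2))

theorem IsInner.mono (hl : IsInner p l) (hpq : p ≤ q) : IsInner q l :=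
  ⟨lt_of_le_of_lt hpq.1 hl.1, lt_of_lt_of_le hl.2 hpq.2⟩

theorem exists_eq_castSucc_succ (h₀ : m ≠ 0) (h₁ : m ≠ Fin.last (N + 1)) :
    ∃ l : Fin N, m = l.castSucc.succ := by
  obtain ⟨m, rfl⟩ := Fin.exists_succ_eq.2 h₀
  obtain ⟨l, rfl⟩ := Fin.exists_castSucc_eq.2 fun h : m = Fin.last N => h₁ (h ▸ Fin.succ_last N)
  exact ⟨l, rfl⟩

theorem exists_isInner (hlo : lo p < m) (hhi : m < hi p) :
    ∃ l, IsInner p l ∧ m = l.castSucc.succ := by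
  obtain ⟨l, rfl⟩ := exists_eq_castSucc_succ (Fin.ne_zero_of_lt hlo) (Fin.ne_last_of_lt hhi)
  exact ⟨l, ⟨hlo, hhi⟩, rfl⟩

theorem withHorizons_last : withHorizons τ (Fin.last (N + 1)) = ⊤ := by
  rw [← Fin.succ_last]
  simp [withHorizons]

theorem withHorizons_castSucc_succ (l : Fin N) : withHorizons τ l.castSucc.succ = τ l := by
  simp [withHorizons]

theorem withHorizons_pos (hτ : ∀ i, 0 < τ i) (m : Fin (N + 2)) : 0 < withHorizons τ m := by
  rcases eq_or_ne m 0 with rfl | h₀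
  · exact EReal.zero_lt_top
  rcases eq_or_ne m (Fin.last _) with rfl | h₁
  · exact withHorizons_last.symm ▸ EReal.zero_lt_top
  obtain ⟨l, rfl⟩ := exists_eq_castSucc_succ h₀ h₁
  rw [withHorizons_castSucc_succ]
  exact_mod_cast hτ l

theorem le_innerMax (hl : IsInner p l) : τ l ≤ innerMax τ p :=
  le_ciSup (f := fun l : {l // IsInner p l} => τ l) (Set.finite_range _).bddAbove ⟨l, hl⟩

theorem withHorizons_le_innerMax (hlo : lo p < m) (hhi : m < hi p) :
    withHorizons τ m ≤ innerMax τ p := by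
  obtain ⟨l, hl, rfl⟩ := exists_isInner hlo hhi
  rw [withHorizons_castSucc_succ]
  exact EReal.coe_le_coe_iff.2 (le_innerMax hl)

theorem innerMax_le_iff (ha : 0 ≤ a) : innerMax τ p ≤ a ↔ ∀ l, IsInner p l → τ l ≤ a :=
  ⟨fun h _ hl => (le_innerMax hl).trans h, fun h => Real.iSup_le (fun l => h l l.2) ha⟩

theorem innerMax_nonneg (hτ : ∀ i, 0 < τ i) (p : IndexPair N) : 0 ≤ innerMax τ p :=
  Real.iSup_nonneg fun l => (hτ l).le

theorem innerMax_eq_zero (hp : ∀ l, ¬ IsInner p l) : innerMax τ p = 0 :=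
  have : IsEmpty {l // IsInner p l} := ⟨fun l => hp l l.2⟩
  Real.iSup_of_isEmpty _

theorem exists_isInner_eq_innerMax (hp : ∃ l, IsInner p l) :
    ∃ l, IsInner p l ∧ τ l = innerMax τ p :=
  have : Nonempty {l // IsInner p l} := let ⟨l, hl⟩ := hp; ⟨⟨l, hl⟩⟩
  let ⟨l, hl⟩ := exists_eq_ciSup_of_finite (f := fun l : {l // IsInner p l} => τ l)
  ⟨l, l.2, hl⟩

theorem innerMax_lt {y : EReal} (hy : 0 < y) (h : ∀ l, IsInner p l → τ l < y) :
    innerMax τ p < y := by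
  by_cases hp : ∃ l, IsInner p l
  · obtain ⟨l, hl, heq⟩ := exists_isInner_eq_innerMax (τ := τ) hp
    exact heq ▸ h l hl
  · rw [innerMax_eq_zero (not_exists.1 hp)]
    exact hy

theorem mem_visiblePairs : p ∈ visiblePairs τ ↔ lo p < hi p ∧
    ∀ l, IsInner p l → τ l < withHorizons τ (lo p) ∧ τ l < withHorizons τ (hi p) := by
  refine and_congr_right fun hp => ?_
  change _ ≠ _ ∧ (∀ m, min (lo p) (hi p) < m → m < max (lo p) (hi p) → _) ↔ _
  rw [min_eq_left hp.le, max_eq_right hp.le, and_iff_right hp.ne]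
  simp only [← withHorizons_castSucc_succ]
  refine ⟨fun h l hl => h _ hl.1 hl.2, fun h m hlo hhi => ?_⟩
  obtain ⟨l, hl, rfl⟩ := exists_isInner hlo hhi
  exact h l hl

theorem isLevelPair_innerMax (hτ : ∀ i, 0 < τ i) (hp : p ∈ visiblePairs τ) :
    IsLevelPair τ (innerMax τ p) p where
  lo_lt_hi := hp.1
  lt_lo := innerMax_lt (withHorizons_pos hτ _) fun l hl => ((mem_visiblePairs.1 hp).2 l hl).1
  lt_hi := innerMax_lt (withHorizons_pos hτ _) fun l hl => ((mem_visiblePairs.1 hp).2 l hl).2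
  innerMax_le := le_rfl

theorem IsLevelPair.mem_visiblePairs (hp : IsLevelPair τ a p) : p ∈ visiblePairs τ :=
  HorizonTree.mem_visiblePairs.2 ⟨hp.lo_lt_hi, fun l hl => by
    have hla : (τ l : EReal) ≤ a := EReal.coe_le_coe_iff.2 ((le_innerMax hl).trans hp.innerMax_le)
    exact ⟨hla.trans_lt hp.lt_lo, hla.trans_lt hp.lt_hi⟩⟩

theorem IsLevelPair.le_of_overlap (hp : IsLevelPair τ a p) (hq : innerMax τ q ≤ a)
    (hpq : lo p < hi q) (hqp : lo q < hi p) : q ≤ p := by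
  have hinner : ∀ m, lo q < m → m < hi q → withHorizons τ m ≤ a := fun m hlo hhi =>
    (withHorizons_le_innerMax hlo hhi).trans (EReal.coe_le_coe_iff.2 hq)
  constructor
  · exact le_of_not_gt fun h => (hinner _ h hpq).not_gt hp.lt_lo
  · exact le_of_not_gt fun h => (hinner _ hqp h).not_gt hp.lt_hi

theorem exists_isLevelPair_ge (ha : 0 ≤ a) (hq : lo q < hi q) (hqa : innerMax τ q ≤ a) :
    ∃ p, q ≤ p ∧ IsLevelPair τ a p := by
  obtain ⟨i, ⟨hiq, hai⟩, hmax⟩ := (wellFounded_gt (α := Fin (N + 2))).has_min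
    {m | m ≤ lo q ∧ a < withHorizons τ m} ⟨0, Fin.zero_le _, EReal.coe_lt_top a⟩
  obtain ⟨j, ⟨hqj, haj⟩, hmin⟩ := (wellFounded_lt (α := Fin (N + 2))).has_min
    {m | hi q ≤ m ∧ a < withHorizons τ m}
    ⟨Fin.last _, Fin.le_last _, withHorizons_last.symm ▸ EReal.coe_lt_top a⟩
  refine ⟨indexPair i j, ⟨hiq, hqj⟩, (hiq.trans_lt hq).trans_le hqj, hai, haj,
    (innerMax_le_iff ha).2 fun l ⟨hil, hlj⟩ => ?_⟩
  by_contra! hl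
  rw [← EReal.coe_lt_coe_iff, ← withHorizons_castSucc_succ] at hl
  rcases le_or_gt l.castSucc.succ (lo q) with hlo | hlo
  · exact hmax _ ⟨hlo, hl⟩ hil
  rcases le_or_gt (hi q) l.castSucc.succ with hhi | hhi
  · exact hmin _ ⟨hhi, hl⟩ hlj
  · exact ((withHorizons_le_innerMax hlo hhi).trans (EReal.coe_le_coe_iff.2 hqa)).not_gt hl

theorem innerMax_strictMonoOn (hτ : ∀ i, 0 < τ i) :
    StrictMonoOn (innerMax τ) (visiblePairs τ) := by
  intro v hv u _ hvu
  by_contra! hle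
  exact hvu.not_ge ((isLevelPair_innerMax hτ hv).le_of_overlap hle
    (lo_lt_hi_of_le hv.1 le_rfl hvu.le) (lo_lt_hi_of_le hv.1 hvu.le le_rfl))

theorem exists_isLeast_visiblePairs_gt (hτ : ∀ i, 0 < τ i) (hw : w ∈ visiblePairs τ)
    (hu : u ∈ visiblePairs τ) (hwu : w < u) : ∃ v, IsLeast {u ∈ visiblePairs τ | w < u} v := by
  obtain ⟨v, ⟨hv, hwv⟩, hmin⟩ := (Set.toFinite {u ∈ visiblePairs τ | w < u}).exists_minimal
    ⟨u, hu, hwu⟩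
  refine ⟨v, ⟨hv, hwv⟩, fun u ⟨hu, hwu⟩ => ?_⟩
  have huv : lo u < hi v := lo_lt_hi_of_le hw.1 hwu.le hwv.le
  have hvu : lo v < hi u := lo_lt_hi_of_le hw.1 hwv.le hwu.le
  rcases le_total (innerMax τ v) (innerMax τ u) with h | h
  · exact (isLevelPair_innerMax hτ hu).le_of_overlap h huv hvu
  · exact hmin ⟨hu, hwu⟩ ((isLevelPair_innerMax hτ hv).le_of_overlap h hvu huv)

theorem isLeaf_visiblePairs_iff (hp : p ∈ visiblePairs τ) :
    IsLeaf (visiblePairs τ) p ↔ ∀ l, ¬ IsInner p l := by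
  constructor
  · intro hleaf l hl
    let q : IndexPair N := indexPair l.castSucc.castSucc l.castSucc.succ
    have hq : q ∈ visiblePairs τ := mem_visiblePairs.2 ⟨Fin.castSucc_lt_succ, fun i hi =>
      absurd hi.2 (Fin.castSucc_lt_iff_succ_le.1 hi.1).not_gt⟩
    have hpq : p ≤ q := hleaf.2 hq ⟨Fin.le_castSucc_iff.2 hl.1, hl.2.le⟩
    exact hl.2.not_ge hpq.2
  · refine fun h => ⟨hp, fun q hq hqp => ⟨le_of_not_gt fun hlt => ?_, le_of_not_gt fun hlt => ?_⟩⟩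
    · obtain ⟨l, hl, -⟩ := exists_isInner hlt (lo_lt_hi_of_le hq.1 le_rfl hqp)
      exact h l hl
    · obtain ⟨l, hl, -⟩ := exists_isInner (lo_lt_hi_of_le hq.1 hqp le_rfl) hlt
      exact h l hl

theorem mem_cutLeaves_visiblePairs :
    p ∈ cutLeaves (visiblePairs τ) ↔ p ∈ visiblePairs τ ∧ ∃ l, IsInner p l := by
  refine and_congr_right fun hp => ?_
  rw [isLeaf_visiblePairs_iff hp]
  push Not
  rfl

theorem innerMax_eq_zero_of_isLeaf (hp : IsLeaf (visiblePairs τ) p) : innerMax τ p = 0 :=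
  innerMax_eq_zero ((isLeaf_visiblePairs_iff hp.1).1 hp)

end VisiblePairs

/-! ### The merge tree of the weighted path -/

section MergeTree

open IndexPair

variable {N : ℕ} {τ : Fin N → ℝ} {p q v w : IndexPair N} {a : ℝ}

/-- The vertices of the weighted path between the ends of a pair `p`: those `v` for which `p` spans
the two regions on either side of the leaf `v` of the merge tree. -/
def segment (p : IndexPair N) : Set (Fin (N + 1)) :=
  {v | lo p ≤ v.castSucc ∧ v.succ ≤ hi p}

theorem exists_castSucc_eq_lo_mem_segment (hp : lo p < hi p) :
    ∃ v ∈ segment p, v.castSucc = lo p := by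
  obtain ⟨v, hv⟩ := Fin.exists_castSucc_eq.2 (Fin.ne_last_of_lt hp)
  exact ⟨v, ⟨hv.ge, Fin.castSucc_lt_iff_succ_le.1 (hv ▸ hp)⟩, hv⟩

theorem exists_succ_eq_hi_mem_segment (hp : lo p < hi p) : ∃ v ∈ segment p, v.succ = hi p := by
  obtain ⟨v, hv⟩ := Fin.exists_succ_eq.2 (Fin.ne_zero_of_lt hp)
  exact ⟨v, ⟨Fin.le_castSucc_iff.2 (hv ▸ hp), hv.le⟩, hv⟩

theorem segment_subset_iff (hp : lo p < hi p) : segment p ⊆ segment q ↔ p ≤ q := by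
  constructor
  · intro hsub
    obtain ⟨v, hv, hvlo⟩ := exists_castSucc_eq_lo_mem_segment hp
    obtain ⟨w, hw, hwhi⟩ := exists_succ_eq_hi_mem_segment hp
    exact ⟨(hsub hv).1.trans_eq hvlo, hwhi.ge.trans (hsub hw).2⟩
  · exact fun hpq v hv => ⟨le_trans (show lo q ≤ lo p from hpq.1) hv.1, hv.2.trans hpq.2⟩

theorem segment_inj (hp : lo p < hi p) (hq : lo q < hi q) (h : segment p = segment q) : p = q :=
  le_antisymm ((segment_subset_iff hp).1 h.subset) ((segment_subset_iff hq).1 h.superset)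

theorem segment_ssubset_iff (hp : lo p < hi p) (hq : lo q < hi q) :
    segment p < segment q ↔ p < q := by
  rw [lt_iff_le_not_ge, lt_iff_le_not_ge]
  exact and_congr (segment_subset_iff hp) (not_congr (segment_subset_iff hq))

theorem onBoundary_segment (hp : lo p < hi p) (g : Fin (N + 2)) :
    OnBoundary (segment p) g ↔ g = lo p ∨ g = hi p := by
  have hsucc : (∃ v ∈ segment p, v.succ = g) ↔ lo p < g ∧ g ≤ hi p := by
    constructor
    · rintro ⟨v, hv, rfl⟩
      exact ⟨Fin.le_castSucc_iff.1 hv.1, hv.2⟩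
    · rintro ⟨hlo, hhi⟩
      obtain ⟨v, rfl⟩ := Fin.exists_succ_eq.2 (Fin.ne_zero_of_lt hlo)
      exact ⟨v, ⟨Fin.le_castSucc_iff.2 hlo, hhi⟩, rfl⟩
  have hcastSucc : (∃ v ∈ segment p, v.castSucc = g) ↔ lo p ≤ g ∧ g < hi p := by
    constructor
    · rintro ⟨v, hv, rfl⟩
      exact ⟨hv.1, Fin.castSucc_lt_iff_succ_le.2 hv.2⟩
    · rintro ⟨hlo, hhi⟩
      obtain ⟨v, rfl⟩ := Fin.exists_castSucc_eq.2 (Fin.ne_last_of_lt hhi)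
      exact ⟨v, ⟨hlo, Fin.castSucc_lt_iff_succ_le.1 hhi⟩, rfl⟩
  rw [OnBoundary, hsucc, hcastSucc, xor_def]
  omega

theorem weightedPath_weight (i : Fin N) :
    (weightedPath τ).weight s(i.castSucc, i.succ) = τ i := by
  have hinj : ∀ j : Fin N, s(i.castSucc, i.succ) = s(j.castSucc, j.succ) ↔ i = j := fun j => by
    simp only [Sym2.eq_iff, Fin.ext_iff, Fin.val_castSucc, Fin.val_succ]
    omega
  simp [weightedPath, hinj]

theorem pathGraph_adj_iff_exists {v w : Fin (N + 1)} : (SimpleGraph.pathGraph (N + 1)).Adj v w ↔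
    ∃ i : Fin N, s(v, w) = s(i.castSucc, i.succ) := by
  simp only [SimpleGraph.pathGraph_adj, Sym2.eq_iff, Fin.ext_iff, Fin.val_castSucc, Fin.val_succ]
  constructor
  · rintro (h | h)
    exacts [⟨⟨v, by omega⟩, Or.inl ⟨rfl, h.symm⟩⟩, ⟨⟨w, by omega⟩, Or.inr ⟨h.symm, rfl⟩⟩]
  · rintro ⟨i, h⟩
    omega

theorem sublevel_adj_iff {v w : Fin (N + 1)} : ((weightedPath τ).sublevel a).Adj v w ↔
    ∃ i, τ i ≤ a ∧ s(v, w) = s(i.castSucc, i.succ) := by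
  refine (and_congr_left' pathGraph_adj_iff_exists).trans ?_
  rw [exists_and_right.symm]
  refine exists_congr fun i => and_comm.trans (and_congr_left fun h => ?_)
  rw [h, weightedPath_weight]

theorem isInner_iff_mem_segment {i : Fin N} :
    IsInner p i ↔ i.castSucc ∈ segment p ∧ i.succ ∈ segment p :=
  ⟨fun h => ⟨⟨Fin.le_castSucc_iff.2 h.1, h.2.le⟩, ⟨h.1.le, Fin.castSucc_lt_iff_succ_le.1 h.2⟩⟩,
    fun h => ⟨Fin.le_castSucc_iff.1 h.1.1, Fin.castSucc_lt_iff_succ_le.2 h.2.2⟩⟩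

theorem IsLevelPair.castSucc_mem_segment_iff (hp : IsLevelPair τ a p) {i : Fin N} (hia : τ i ≤ a) :
    i.castSucc ∈ segment p ↔ i.succ ∈ segment p := by
  rw [← EReal.coe_le_coe_iff, ← withHorizons_castSucc_succ] at hia
  have hlo : lo p ≠ i.castSucc.succ := fun h => (h ▸ hia).not_gt hp.lt_lo
  have hhi : i.castSucc.succ ≠ hi p := fun h => (h ▸ hia).not_gt hp.lt_hi
  constructor <;> intro h
  · exact (isInner_iff_mem_segment.1 ⟨Fin.le_castSucc_iff.1 h.1, h.2.lt_of_ne hhi⟩).2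
  · exact (isInner_iff_mem_segment.1 ⟨h.1.lt_of_ne hlo, Fin.castSucc_lt_iff_succ_le.2 h.2⟩).1

theorem reachable_sublevel_of_mem_segment (hp : innerMax τ p ≤ a) {v w : Fin (N + 1)}
    (hv : v ∈ segment p) (hw : w ∈ segment p) : ((weightedPath τ).sublevel a).Reachable v w := by
  wlog hvw : v ≤ w generalizing v w
  · exact (this hw hv (le_of_not_ge hvw)).symm
  rw [SimpleGraph.reachable_iff_reflTransGen]
  refine reflTransGen_of_succ_of_le _ (fun u hu => ?_) hvw
  obtain ⟨i, rfl⟩ := Fin.exists_castSucc_eq.2 (Fin.ne_last_of_lt hu.2)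
  rw [Fin.orderSucc_castSucc, sublevel_adj_iff]
  refine ⟨i, (le_innerMax ⟨?_, ?_⟩).trans hp, rfl⟩
  · exact Fin.le_castSucc_iff.1 (hv.1.trans hu.1)
  · exact lt_of_lt_of_le (Fin.succ_lt_succ_iff.2 hu.2) hw.2

theorem IsLevelPair.supp_eq_segment (hp : IsLevelPair τ a p) {v : Fin (N + 1)}
    (hv : v ∈ segment p) :
    (((weightedPath τ).sublevel a).connectedComponentMk v).supp = segment p := by
  ext w
  rw [SimpleGraph.ConnectedComponent.mem_supp_iff, SimpleGraph.ConnectedComponent.eq]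
  constructor
  · rintro ⟨walk⟩
    induction walk with
    | nil => exact hv
    | cons hadj _ ih =>
      obtain ⟨i, hia, heq⟩ := sublevel_adj_iff.1 hadj
      have hiff := hp.castSucc_mem_segment_iff hia
      obtain ⟨rfl, rfl⟩ | ⟨rfl, rfl⟩ := Sym2.eq_iff.1 heq
      exacts [hiff.2 (ih hv), hiff.1 (ih hv)]
  · exact fun hw => reachable_sublevel_of_mem_segment hp.innerMax_le hw hv

theorem isComponent_iff (ha : 0 ≤ a) {C : Set (Fin (N + 1))} :
    (weightedPath τ).IsComponent a C ↔ ∃ p, IsLevelPair τ a p ∧ segment p = C := by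
  constructor
  · rintro ⟨c, rfl⟩
    induction c using SimpleGraph.ConnectedComponent.ind with
    | _ v =>
      have hinner : ∀ l, ¬ IsInner (indexPair v.castSucc v.succ) l := fun l hl =>
        (Fin.castSucc_lt_iff_succ_le.1 hl.1).not_gt hl.2
      obtain ⟨p, hvp, hp⟩ := exists_isLevelPair_ge (q := indexPair v.castSucc v.succ) ha
        Fin.castSucc_lt_succ ((innerMax_eq_zero (τ := τ) hinner).trans_le ha)
      exact ⟨p, hp, (hp.supp_eq_segment hvp).symm⟩
  · rintro ⟨p, hp, rfl⟩
    obtain ⟨v, hv, -⟩ := exists_castSucc_eq_lo_mem_segment hp.lo_lt_hi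
    exact ⟨_, hp.supp_eq_segment hv⟩

theorem mem_mergeTree_nodes (hτ : ∀ i, 0 < τ i) {C : Set (Fin (N + 1))} :
    C ∈ (weightedPath τ).mergeTree.nodes ↔ ∃ p ∈ visiblePairs τ, segment p = C := by
  constructor
  · rintro ⟨a, ha, hC⟩
    obtain ⟨p, hp, rfl⟩ := (isComponent_iff ha).1 hC
    exact ⟨p, hp.mem_visiblePairs, rfl⟩
  · rintro ⟨p, hp, rfl⟩
    have hnonneg := innerMax_nonneg hτ p
    exact ⟨_, hnonneg, (isComponent_iff hnonneg).2 ⟨p, isLevelPair_innerMax hτ hp, rfl⟩⟩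

theorem mergeTree_height_segment (hτ : ∀ i, 0 < τ i) (hp : p ∈ visiblePairs τ) :
    (weightedPath τ).mergeTree.height (segment p) = innerMax τ p := by
  have hnonneg := innerMax_nonneg hτ p
  refine IsLeast.csInf_eq ⟨⟨hnonneg,
    (isComponent_iff hnonneg).2 ⟨p, isLevelPair_innerMax hτ hp, rfl⟩⟩, ?_⟩
  rintro a ⟨ha, hC⟩
  obtain ⟨q, hq, heq⟩ := (isComponent_iff ha).1 hC
  exact segment_inj hq.lo_lt_hi hp.1 heq ▸ hq.innerMax_le

theorem edgeLength_segment (hτ : ∀ i, 0 < τ i) (r : ℝ) (hw : w ∈ visiblePairs τ)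
    (hv : IsLeast {u ∈ visiblePairs τ | w < u} v) :
    (weightedPath τ).mergeTree.edgeLength r (segment w) = innerMax τ v - innerMax τ w := by
  obtain ⟨⟨hv, hwv⟩, hmin⟩ := hv
  have hmem := (mem_mergeTree_nodes hτ).2 ⟨v, hv, rfl⟩
  have hlt := (segment_ssubset_iff hw.1 hv.1).2 hwv
  rw [HeightTree.edgeLength, if_pos ⟨_, hmem, hlt⟩, mergeTree_height_segment hτ hw]
  congr 1
  refine IsLeast.csInf_eq ⟨⟨_, ⟨hmem, hlt⟩, mergeTree_height_segment hτ hv⟩, ?_⟩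
  rintro _ ⟨C, ⟨hC, hlt'⟩, rfl⟩
  obtain ⟨u, hu, rfl⟩ := (mem_mergeTree_nodes hτ).1 hC
  rw [mergeTree_height_segment hτ hu]
  exact (innerMax_strictMonoOn hτ).monotoneOn hv hu
    (hmin ⟨hu, (segment_ssubset_iff hw.1 hu.1).1 hlt'⟩)

theorem eq_of_onBoundary_segment (hp : lo p < hi p) (hq : lo q < hi q)
    (hlo : OnBoundary (segment q) (lo p)) (hhi : OnBoundary (segment q) (hi p)) : q = p := by
  rw [onBoundary_segment hq] at hlo hhi
  refine Prod.ext (congrArg OrderDual.toDual (?_ : lo q = lo p)) (?_ : hi q = hi p) <;> omega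

theorem persistenceWeightedHVG_weight (hτ : ∀ i, 0 < τ i) (r : ℝ) (hp : p ∈ visiblePairs τ) :
    (persistenceWeightedHVG τ r).weight s(lo p, hi p) =
      (weightedPath τ).mergeTree.edgeLength r (segment p) := by
  dsimp only [persistenceWeightedHVG]
  refine Finset.sum_eq_single_of_mem (segment p) ?_ fun C hC hne => (hne ?_).elim
  · simp only [Finset.mem_filter, Finset.mem_univ, true_and, Sym2.mem_iff, forall_eq_or_imp,
      forall_eq, onBoundary_segment hp.1, true_or, or_true, and_true, mem_mergeTree_nodes hτ]
    exact ⟨p, hp, rfl⟩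
  · simp only [Finset.mem_filter, Finset.mem_univ, true_and, Sym2.mem_iff, forall_eq_or_imp,
      forall_eq, mem_mergeTree_nodes hτ] at hC
    obtain ⟨⟨q, hq, rfl⟩, hlo, hhi⟩ := hC
    rw [eq_of_onBoundary_segment hp.1 hq.1 hlo hhi]

theorem dualTree_height (hτ : ∀ i, 0 < τ i) (r : ℝ) (hp : p ∈ visiblePairs τ) :
    (dualTree (persistenceWeightedHVG τ r)).height p = innerMax τ p := by
  refine heightOfLengths_eq (fun w hw u hu hwu => ?_)
    (fun l hl => innerMax_eq_zero_of_isLeaf hl) hp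
  obtain ⟨v, hv⟩ := exists_isLeast_visiblePairs_gt hτ hw hu hwu
  exact ⟨v, hv, (persistenceWeightedHVG_weight hτ r hw).trans (edgeLength_segment hτ r hw hv)⟩

end MergeTree

/-! ### The dual tree without its leaves -/

section CutDualTree

open IndexPair

variable {N : ℕ} {τ : Fin N → ℝ} {l m j : Fin N} {a : ℝ}

theorem isInner_indexPair_iff :
    IsInner (indexPair l.castSucc.castSucc m.succ.succ) j ↔ l ≤ j ∧ j ≤ m := by
  change l.castSucc.castSucc < j.castSucc.succ ∧ j.castSucc.succ < m.succ.succ ↔ _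
  rw [Fin.castSucc_lt_succ_iff, Fin.succ_lt_succ_iff, Fin.castSucc_lt_succ_iff,
    Fin.castSucc_le_castSucc_iff]

theorem sameComponent_sampleTime_iff_exists_isLevelPair (hτ : ∀ i, 0 < τ i) :
    SameComponent (piecewiseLinear τ) a (sampleTime l) (sampleTime m) ↔
      ∃ p, IsLevelPair τ a p ∧ IsInner p l ∧ IsInner p m := by
  wlog hlm : l ≤ m generalizing l m
  · refine Iff.trans ⟨SameComponent.symm, SameComponent.symm⟩ ((this (le_of_not_ge hlm)).trans ?_)
    simp only [and_comm]
  rw [sameComponent_sampleTime_iff hlm]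
  constructor
  · intro h
    have ha : 0 ≤ a := (hτ l).le.trans (h l le_rfl hlm)
    obtain ⟨p, hle, hp⟩ := exists_isLevelPair_ge (τ := τ)
      (q := indexPair l.castSucc.castSucc m.succ.succ) ha
      ((Fin.castSucc_lt_succ (i := l.castSucc)).trans
        (Fin.succ_lt_succ_iff.2 (Fin.castSucc_lt_succ_iff.2 hlm)))
      ((innerMax_le_iff ha).2 fun j hj => h j (isInner_indexPair_iff.1 hj).1
        (isInner_indexPair_iff.1 hj).2)
    exact ⟨p, hp, (isInner_indexPair_iff.2 ⟨le_rfl, hlm⟩).mono hle,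
      (isInner_indexPair_iff.2 ⟨hlm, le_rfl⟩).mono hle⟩
  · rintro ⟨p, hp, hl, hm⟩ j hlj hjm
    exact (le_innerMax ⟨hl.1.trans_le (Fin.succ_le_succ_iff.2 hlj),
      lt_of_le_of_lt (Fin.succ_le_succ_iff.2 hjm) hm.2⟩).trans hp.innerMax_le

theorem IsLevelPair.le_of_isInner {p q : IndexPair N} (hp : IsLevelPair τ a p) (hpl : IsInner p l)
    (hql : IsInner q l) (hl : τ l = innerMax τ q) : q ≤ p :=
  hp.le_of_overlap (hl.symm.trans_le ((le_innerMax hpl).trans hp.innerMax_le))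
    (hpl.1.trans hql.2) (hql.1.trans hpl.2)

theorem exists_isMergeTreeOf_cutLeaves_dualTree (hτ : ∀ i, 0 < τ i) (r : ℝ) :
    ∃ pt, HeightTree.IsMergeTreeOf
      ⟨cutLeaves (dualTree (persistenceWeightedHVG τ r)).nodes,
        (dualTree (persistenceWeightedHVG τ r)).height⟩ (piecewiseLinear τ) pt := by
  choose peak hpeak using fun v : cutLeaves (visiblePairs τ) =>
    exists_isInner_eq_innerMax (τ := τ) (mem_cutLeaves_visiblePairs.1 v.2).2
  have hheight : Set.EqOn (dualTree (persistenceWeightedHVG τ r)).height (innerMax τ)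
      (cutLeaves (visiblePairs τ)) := fun p hp => dualTree_height hτ r hp.1
  refine ⟨fun v => sampleTime (peak v),
    ((innerMax_strictMonoOn hτ).mono (Set.sep_subset _ _)).congr hheight.symm, ?_, ?_⟩
  · intro x a hx
    obtain ⟨i, hi⟩ := exists_sameComponent_sampleTime hx
    obtain ⟨p, hp, hpi, -⟩ := (sameComponent_sampleTime_iff_exists_isLevelPair hτ).1
      (hi.symm.trans hi)
    let v : cutLeaves (visiblePairs τ) :=
      ⟨p, mem_cutLeaves_visiblePairs.2 ⟨hp.mem_visiblePairs, i, hpi⟩⟩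
    exact ⟨v, hi.trans ((sameComponent_sampleTime_iff_exists_isLevelPair hτ).2
      ⟨p, hp, hpi, (hpeak v).1⟩)⟩
  · intro v w a
    refine (sameComponent_sampleTime_iff_exists_isLevelPair hτ).trans ⟨?_, ?_⟩
    · rintro ⟨p, hp, hpv, hpw⟩
      have hmem := mem_cutLeaves_visiblePairs.2 ⟨hp.mem_visiblePairs, _, hpv⟩
      exact ⟨p, hmem, hp.le_of_isInner hpv (hpeak v).1 (hpeak v).2,
        hp.le_of_isInner hpw (hpeak w).1 (hpeak w).2, (hheight hmem).trans_le hp.innerMax_le⟩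
    · rintro ⟨u, hu, hvu, hwu, hua⟩
      replace hua : innerMax τ u ≤ a := (hheight hu).symm.trans_le hua
      obtain ⟨p, hup, hp⟩ := exists_isLevelPair_ge ((innerMax_nonneg hτ u).trans hua) hu.1.1 hua
      exact ⟨p, hp, (hpeak v).1.mono (hvu.trans hup), (hpeak w).1.mono (hwu.trans hup)⟩

end CutDualTree

end HorizonTree

end

theorem mainTheorem6 {N : ℕ} (hN : 1 ≤ N) (τ : Fin N → ℝ) (hτ : ∀ i, 0 < τ i)
    (r : ℝ) (hr : 0 < r)
    (tie : (Fin (N + 2))ᵒᵈ × Fin (N + 2) → (Fin (N + 2))ᵒᵈ × Fin (N + 2) → Prop)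
    (htie : IsStrictTotalOrder ((Fin (N + 2))ᵒᵈ × Fin (N + 2)) tie)
    (k : Type*) [Field k] :
    HorizonTree.IsBarcode
      (HorizonTree.sublevelH0 k (HorizonTree.piecewiseLinear τ))
      ((HorizonTree.dualTree (HorizonTree.persistenceWeightedHVG τ r)).hortonPruning.elderRule
        tie) := by
  obtain ⟨pt, hpt⟩ := HorizonTree.exists_isMergeTreeOf_cutLeaves_dualTree hτ r
  exact hpt.suppressDegreeTwo.isBarcode_elderRule (tie := tie) k
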